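/- Let $\{z_t\}_{t\ge 1}$ be white noise (square integrable, mean zero, pairwise uncorrelated) with variance $1$, let $\rho\in(-1,1)\setminus\{0\}$ and $\varepsilon\neq 0$ be fixed, and for $n\ge 1$ let $1\le k=k_n\le n$ with $k_n\to\infty$ as $n\to\infty$. Let $B_n=[\mathrm{var}(y_1,\dots,y_n)]^{-1}$ be the precision matrix of the single structural change model $y_0=0$, $y_t=\rho_t y_{t-1}+z_t$, $\rho_t=\rho+\varepsilon\,1\{t=k_n\}$ ($1\le t\le n$). Put $a_\rho=(1-|\rho|)^2$, $b_\rho=(1+|\rho|)^2$, and let $\mu_\rho$ be the law of $1+\rho^2-2\rho\cos U$ with $U$ uniform on $[0,2\pi]$. The support of $\mu_\rho$ is $[a_\rho,b_\rho]$, and the empirical spectral distributions of $B_n$ converge weakly to $\mu_\rho$. Call $x\in\mathbb R$ an outlier of $\{B_n\}$ if $x\notin[a_\rho,b_\rho]$ and $\lim_{n\to\infty}\min_{\lambda\in \mathrm{spec}(B_n)}|x-\lambda|=0$; let $out_L(\{B_n\})$ and $out_R(\{B_n\})$ be the sets of outliers $x<a_\rho$ and $x>b_\rho$, respectively. 1.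 If $|\rho+\varepsilon|\le|\rho|$, then $out_L(\{B_n\})=out_R(\{B_n\})=\emptyset$. 2. If $|\rho+\varepsilon|>|\rho|$ and moreover $n-k_n\to\infty$, then $out_L(\{B_n\})=\{m\}$ and $out_R(\{B_n\})=\{M\}$, where, with $$s,t=\frac{\rho\varepsilon(\varepsilon+2\rho)\mp\sqrt{\rho^2\varepsilon^2(\varepsilon+2\rho)^2+4\rho^2(\varepsilon+\rho)^2}}{2(\varepsilon+\rho)^2}\qquad(s \text{ with } -,\ t \text{ with } +),$$ the two roots of $-(\varepsilon+\rho)^2x^2+\varepsilon\rho(\varepsilon+2\rho)x+\rho^2=0$, $$m=1+\rho^2-\rho(s+s^{-1}),\quad M=1+\rho^2-\rho(t+t^{-1})\qquad\text{if }-1<\rho<0,$$ $$m=1+\rho^2-\rho(t+t^{-1}),\quad M=1+\rho^2-\rho(s+s^{-1})\qquad\text{if }0<\rho<1.$$ -/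

import Mathlib

open MeasureTheory ProbabilityTheory Filter Topology

noncomputable section

/-- Unit-variance white noise `z 1, z 2, …`: square integrable, centred, with second moment `1`,
and pairwise uncorrelated. -/
structure IsWhiteNoise {Ω : Type*} [MeasurableSpace Ω] (P : Measure Ω) (z : ℕ → Ω → ℝ) :
    Prop where
  memLp : ∀ t, 1 ≤ t → MemLp (z t) 2 P
  mean_zero : ∀ t, 1 ≤ t → ∫ ω, z t ω ∂P = 0
  second_moment : ∀ t, 1 ≤ t → ∫ ω, (z t ω) ^ 2 ∂P = 1
  uncorrelated : ∀ s t, 1 ≤ s → 1 ≤ t → s ≠ t → cov[z s, z t; P] = 0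

/-- The autoregressive process of order one with time-dependent coefficients `a t`, driven by `z`:
`y 0 = 0` and `y t = a t * y (t - 1) + z t` for `t ≥ 1`. -/
def arProcess {Ω : Type*} (a : ℕ → ℝ) (z : ℕ → Ω → ℝ) : ℕ → Ω → ℝ
  | 0 => fun _ => 0
  | t + 1 => fun ω => a (t + 1) * arProcess a z t ω + z (t + 1) ω

/-- The coefficients `ρ_t = ρ + ε · 1{t = k}` of the single structural change model. -/
def scmCoeff (ρ ε : ℝ) (k t : ℕ) : ℝ := ρ + if t = k then ε else 0

/-- The covariance matrix of the random vector `(y 1, …, y n)`. -/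
def covMatrix {Ω : Type*} [MeasurableSpace Ω] (P : Measure Ω) (y : ℕ → Ω → ℝ) (n : ℕ) :
    Matrix (Fin n) (Fin n) ℝ :=
  Matrix.of fun i j => cov[y (i.val + 1), y (j.val + 1); P]

/-- The precision matrix of `(y 1, …, y n)`: the inverse of its covariance matrix. -/
def precisionMatrix {Ω : Type*} [MeasurableSpace Ω] (P : Measure Ω) (y : ℕ → Ω → ℝ) (n : ℕ) :
    Matrix (Fin n) (Fin n) ℝ :=
  (covMatrix P y n)⁻¹

/-- The precision matrix `B_n` of `n` observations from the single structural change model with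
break point `k`. -/
def scmPrecision {Ω : Type*} [MeasurableSpace Ω] (P : Measure Ω) (z : ℕ → Ω → ℝ)
    (ρ ε : ℝ) (k n : ℕ) : Matrix (Fin n) (Fin n) ℝ :=
  precisionMatrix P (arProcess (scmCoeff ρ ε k) z) n

/-- The empirical spectral distribution of a real symmetric matrix: the average of the Dirac
measures at its eigenvalues, counted with multiplicity. -/
def esd {n : ℕ} (A : Matrix (Fin n) (Fin n) ℝ) (hA : A.IsHermitian) : Measure ℝ :=
  (n : ENNReal)⁻¹ • ∑ i, Measure.dirac (hA.eigenvalues i)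

/-- `μ` is the asymptotic spectral distribution of the sequence of symmetric matrices `A n`:
their empirical spectral distributions converge weakly to `μ`. -/
def HasASD (A : (n : ℕ) → Matrix (Fin n) (Fin n) ℝ) (μ : Measure ℝ) : Prop :=
  ∃ hA : ∀ n, (A n).IsHermitian, ∀ f : BoundedContinuousFunction ℝ ℝ,
    Tendsto (fun n => ∫ x, f x ∂(esd (A n) (hA n))) atTop (𝓝 (∫ x, f x ∂μ))

/-- The outliers of a sequence `A n` with asymptotic spectral distribution `μ`: the points whose
distance to the spectrum of `A n` tends to `0` and which are not in the closed support of `μ`. -/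
def outliers (A : (n : ℕ) → Matrix (Fin n) (Fin n) ℝ) (μ : Measure ℝ) : Set ℝ :=
  {x | Tendsto (fun n => Metric.infDist x (spectrum ℝ (A n))) atTop (𝓝 0) ∧
    x ∉ closure μ.support}

/-- The outliers to the left of `a`, the left end point of the support of `μ`. -/
def leftOutliers (A : (n : ℕ) → Matrix (Fin n) (Fin n) ℝ) (μ : Measure ℝ) (a : ℝ) : Set ℝ :=
  outliers A μ ∩ Set.Iio a

/-- The outliers to the right of `b`, the right end point of the support of `μ`. -/
def rightOutliers (A : (n : ℕ) → Matrix (Fin n) (Fin n) ℝ) (μ : Measure ℝ) (b : ℝ) : Set ℝ :=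
  outliers A μ ∩ Set.Ioi b

/-- `a_ρ = (1 - |ρ|)²`. -/
def aBound (ρ : ℝ) : ℝ := (1 - |ρ|) ^ 2

/-- `b_ρ = (1 + |ρ|)²`. -/
def bBound (ρ : ℝ) : ℝ := (1 + |ρ|) ^ 2

/-- The measure `μ_ρ`: the law of `1 + ρ² - 2ρ cos x` for `x` uniform on `(0, 2π]`. -/
def muRho (ρ : ℝ) : Measure ℝ :=
  (ENNReal.ofReal (2 * Real.pi)⁻¹ • volume.restrict (Set.Ioc 0 (2 * Real.pi))).map
    (fun x => 1 + ρ ^ 2 - 2 * ρ * Real.cos x)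

/-- The smaller root `s` of `-(ε + ρ)² x² + ερ(ε + 2ρ) x + ρ² = 0`. -/
def rootS (ρ ε : ℝ) : ℝ :=
  (ρ * ε * (ε + 2 * ρ) -
    √(ρ ^ 2 * ε ^ 2 * (ε + 2 * ρ) ^ 2 + 4 * ρ ^ 2 * (ε + ρ) ^ 2)) / (2 * (ε + ρ) ^ 2)

/-- The larger root `t` of `-(ε + ρ)² x² + ερ(ε + 2ρ) x + ρ² = 0`. -/
def rootT (ρ ε : ℝ) : ℝ :=
  (ρ * ε * (ε + 2 * ρ) +
    √(ρ ^ 2 * ε ^ 2 * (ε + 2 * ρ) ^ 2 + 4 * ρ ^ 2 * (ε + ρ) ^ 2)) / (2 * (ε + ρ) ^ 2)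

/-- `x ↦ 1 + ρ² - ρ (x + x⁻¹)`. -/
def spectralMap (ρ x : ℝ) : ℝ := 1 + ρ ^ 2 - ρ * (x + x⁻¹)

/-- The left outlier `m`. -/
def outlierLeft (ρ ε : ℝ) : ℝ :=
  if ρ < 0 then spectralMap ρ (rootS ρ ε) else spectralMap ρ (rootT ρ ε)

/-- The right outlier `M`. -/
def outlierRight (ρ ε : ℝ) : ℝ :=
  if ρ < 0 then spectralMap ρ (rootT ρ ε) else spectralMap ρ (rootS ρ ε)

end

/-! Write `L` for `arOperator`. Since `L y = z` has identity covariance, the precision matrix is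
exactly `Lᵀ L` (`precisionMatrix_arProcess`), a tridiagonal matrix that is Toeplitz with symbol `1 +
ρ² - 2ρ cos θ` except near the break and the two ends.

The limit law follows by moments: all but at most `4m` diagonal entries of the `m`-th power equal
the zeroth Fourier coefficient of the `m`-th power of the symbol, and polynomial approximation on a
common compact interval passes to bounded continuous functions (`hasASD_arGram`).

Outliers are read off the quadratic form `‖L v‖²`. If every coefficient is at most `|ρ|` in absolute
value, it lies between `(1 - |ρ|)² ‖v‖²` and `(1 + |ρ|)² ‖v‖²`, so nothing escapes. In general the
exceptional coefficient only multiplies `v_{k-1}`, so the same bounds hold on the hyperplane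
`v_{k-1} = 0`; hence each side carries at most one distinct outlying eigenvalue
(`eq_of_spectrum_lt_aBound`, `eq_of_bBound_lt_spectrum`). If `|ρ + ε| > |ρ|`, both roots of the
quadratic lie in `(-1, 1)`, and each gives a mode localized at the break whose eigenvalue equation
fails only at the two ends, by a vanishing amount (`tendsto_infDist_spectralMap`). Existence and
uniqueness together identify the outliers. -/

/-! ### The autoregressive operator and its Gram matrix -/

/-- The lower bidiagonal matrix `L` with `(L y)_t = y_t - a t * y_{t-1}`, for `y` indexed by the
times `1, …, n`. -/
def arOperator (a : ℕ → ℝ) (n : ℕ) : Matrix (Fin n) (Fin n) ℝ :=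
  Matrix.of fun i j =>
    if j = i then 1 else if i.val = j.val + 1 then -a (i.val + 1) else 0

/-- A vector indexed by the times `1, …, n`, extended by zero to all times. -/
def timeExtend {n : ℕ} (v : Fin n → ℝ) : ℕ → ℝ
  | 0 => 0
  | t + 1 => if h : t < n then v ⟨t, h⟩ else 0

@[simp]
theorem timeExtend_zero {n : ℕ} (v : Fin n → ℝ) : timeExtend v 0 = 0 := rfl

@[simp]
theorem timeExtend_val_succ {n : ℕ} (v : Fin n → ℝ) (i : Fin n) :
    timeExtend v (i.val + 1) = v i := by
  simp [timeExtend]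

theorem sum_arOperator_row (a : ℕ → ℝ) {n : ℕ} (i : Fin n) (g : ℕ → ℝ) (hg : g 0 = 0) :
    ∑ j, arOperator a n i j * g (j.val + 1) = g (i.val + 1) - a (i.val + 1) * g i.val := by
  have h : ∀ j : Fin n, arOperator a n i j * g (j.val + 1) =
      (if j = i then g (j.val + 1) else 0) -
        (if i.val = j.val + 1 then a (i.val + 1) * g i.val else 0) := by
    intro j
    simp only [arOperator, Matrix.of_apply]
    by_cases h1 : j = i
    · have : i.val ≠ j.val + 1 := by rw [h1]; omega
      simp [h1]
    · by_cases h2 : i.val = j.val + 1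
      · simp [h1, h2]
      · simp [h1, h2]
  simp only [h, Finset.sum_sub_distrib]
  rw [Finset.sum_ite_eq' Finset.univ i (fun j : Fin n => g (j.val + 1))]
  simp only [Finset.mem_univ, if_true]
  congr 1
  obtain ⟨i, hi⟩ := i
  cases i with
  | zero => simp [hg]
  | succ l =>
    have : ∀ j : Fin n, (l = j.val) ↔ j = ⟨l, by omega⟩ := by
      intro j; rw [Fin.ext_iff]; exact eq_comm
    simp [this]

theorem sum_arOperator_col (a : ℕ → ℝ) {n : ℕ} (j : Fin n) (w : ℕ → ℝ) (hw : w (n + 1) = 0) :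
    ∑ i, arOperator a n i j * w (i.val + 1) =
      w (j.val + 1) - a (j.val + 2) * w (j.val + 2) := by
  have h : ∀ i : Fin n, arOperator a n i j * w (i.val + 1) =
      (if i = j then w (i.val + 1) else 0) -
        (if i.val = j.val + 1 then a (j.val + 2) * w (j.val + 2) else 0) := by
    intro i
    simp only [arOperator, Matrix.of_apply]
    by_cases h1 : i = j
    · simp [h1]
    · by_cases h2 : i.val = j.val + 1
      · simp [h1, h2, Ne.symm h1]
      · simp [h1, h2, Ne.symm h1]
  simp only [h, Finset.sum_sub_distrib]
  rw [Finset.sum_ite_eq' Finset.univ j (fun i : Fin n => w (i.val + 1))]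
  simp only [Finset.mem_univ, if_true]
  congr 1
  by_cases hj : j.val + 1 < n
  · have : ∀ i : Fin n, (i.val = j.val + 1) ↔ i = ⟨j.val + 1, hj⟩ := by
      intro i; rw [Fin.ext_iff]
    simp [this]
  · have h1 : ∀ i : Fin n, ¬ (i.val = j.val + 1) := fun i => by omega
    have h2 : j.val + 2 = n + 1 := by omega
    simp [h1, h2, hw]

theorem arOperator_mulVec (a : ℕ → ℝ) {n : ℕ} (v : Fin n → ℝ) (i : Fin n) :
    (arOperator a n).mulVec v i = v i - a (i.val + 1) * timeExtend v i.val := by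
  have := sum_arOperator_row a i (timeExtend v) rfl
  simpa [Matrix.mulVec, dotProduct] using this

/-- The Gram matrix `Lᵀ L` of `arOperator`. -/
def arGram (a : ℕ → ℝ) (n : ℕ) : Matrix (Fin n) (Fin n) ℝ :=
  (arOperator a n).transpose * arOperator a n

theorem arGram_isHermitian (a : ℕ → ℝ) (n : ℕ) : (arGram a n).IsHermitian := by
  have := Matrix.isHermitian_conjTranspose_mul_self (arOperator a n)
  rwa [Matrix.conjTranspose_eq_transpose_of_trivial] at this

/-- Applying `L` and then its transpose gives a second-order recurrence. The last row lacks its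
forward term because no equation at time `n + 1` is imposed. -/
theorem sum_arGram_row (a : ℕ → ℝ) {n : ℕ} (i : Fin n) (g : ℕ → ℝ) (hg : g 0 = 0) :
    ∑ j, arGram a n i j * g (j.val + 1) =
      (g (i.val + 1) - a (i.val + 1) * g i.val) -
        if i.val + 1 < n then
          a (i.val + 2) * (g (i.val + 2) - a (i.val + 2) * g (i.val + 1)) else 0 := by
  set w : ℕ → ℝ := fun t => if t ≤ n then g t - a t * g (t - 1) else 0 with hw
  have h1 : ∑ j, arGram a n i j * g (j.val + 1) =
      ∑ l, arOperator a n l i * w (l.val + 1) := by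
    simp only [arGram, Matrix.mul_apply, Matrix.transpose_apply, Finset.sum_mul]
    rw [Finset.sum_comm]
    refine Finset.sum_congr rfl fun l _ => ?_
    simp only [mul_assoc]
    rw [← Finset.mul_sum, sum_arOperator_row a l g hg]
    have : l.val + 1 ≤ n := l.2
    simp [hw, this]
  rw [h1, sum_arOperator_col a i w (by simp [hw])]
  have : i.val + 1 ≤ n := i.2
  simp only [hw, this, if_true, Nat.add_sub_cancel]
  congr 1
  by_cases h : i.val + 1 < n
  · simp [h, show i.val + 2 ≤ n by omega]
  · simp [h, show ¬ i.val + 2 ≤ n by omega]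

/-! ### The precision matrix is the Gram matrix -/

theorem memLp_arProcess {Ω : Type*} [MeasurableSpace Ω] {P : Measure Ω}
    {z : ℕ → Ω → ℝ} (hz : IsWhiteNoise P z)
    (a : ℕ → ℝ) (t : ℕ) :
    MemLp (arProcess a z t) 2 P := by
  induction t with
  | zero => exact MemLp.zero'
  | succ t ih => exact (ih.const_mul (a (t + 1))).add (hz.memLp (t + 1) (by omega))

theorem arProcess_succ_sub {Ω : Type*} (a : ℕ → ℝ) (z : ℕ → Ω → ℝ) (t : ℕ) :
    z (t + 1) = arProcess a z (t + 1) - a (t + 1) • arProcess a z t := by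
  ext ω; simp [arProcess]

theorem IsWhiteNoise.cov_self {Ω : Type*} [MeasurableSpace Ω] {P : Measure Ω}
    {z : ℕ → Ω → ℝ} (hz : IsWhiteNoise P z)
    {t : ℕ} (ht : 1 ≤ t) :
    cov[z t, z t; P] = 1 := by
  simp [covariance, hz.mean_zero t ht, ← sq, hz.second_moment t ht]

/-- By bilinearity, applying `L` to each argument of the covariance replaces `y` by the noise. -/
theorem covMatrix_arProcess {Ω : Type*} [MeasurableSpace Ω] {P : Measure Ω}
    [IsProbabilityMeasure P] {z : ℕ → Ω → ℝ} (hz : IsWhiteNoise P z)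
    (a : ℕ → ℝ) (n : ℕ) :
    arOperator a n * covMatrix P (arProcess a z) n * (arOperator a n).transpose = 1 := by
  have hy := memLp_arProcess hz a
  have h1 : ∀ i j : Fin n, (arOperator a n * covMatrix P (arProcess a z) n) i j =
      cov[z (i.val + 1), arProcess a z (j.val + 1); P] := by
    intro i j
    rw [Matrix.mul_apply]
    have := sum_arOperator_row a i
      (fun t => cov[arProcess a z t, arProcess a z (j.val + 1); P])
      (by change cov[0, _; P] = 0; exact covariance_zero_left)
    simp only [covMatrix, Matrix.of_apply]
    rw [this, arProcess_succ_sub a z i, covariance_sub_left (hy _) ((hy _).const_smul _) (hy _),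
      covariance_smul_left]
  ext i j
  rw [Matrix.mul_apply]
  have := sum_arOperator_row a j (fun t => cov[z (i.val + 1), arProcess a z t; P])
      (by change cov[_, 0; P] = 0; exact covariance_zero_right)
  have h2 : cov[z (i.val + 1), z (j.val + 1); P] =
      cov[z (i.val + 1), arProcess a z (j.val + 1); P] -
        a (j.val + 1) * cov[z (i.val + 1), arProcess a z j.val; P] := by
    conv_lhs => rw [arProcess_succ_sub a z j]
    rw [covariance_sub_right (hz.memLp _ (by omega)) (hy _) ((hy _).const_smul _),
      covariance_smul_right]
  simp only [h1, Matrix.transpose_apply]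
  simp only [mul_comm (arOperator a n j _)] at this
  rw [this, ← h2, Matrix.one_apply]
  split_ifs with hij
  · rw [hij, hz.cov_self (by omega)]
  · exact hz.uncorrelated _ _ (by omega) (by omega) (fun h => hij (Fin.ext (by omega)))

theorem precisionMatrix_arProcess {Ω : Type*} [MeasurableSpace Ω] {P : Measure Ω}
    [IsProbabilityMeasure P] {z : ℕ → Ω → ℝ} (hz : IsWhiteNoise P z)
    (a : ℕ → ℝ) (n : ℕ) :
    precisionMatrix P (arProcess a z) n = arGram a n := by
  have h := covMatrix_arProcess hz a n
  rw [mul_assoc] at h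
  have h' := mul_eq_one_comm.mp h
  rw [mul_assoc] at h'
  exact Matrix.inv_eq_right_inv h'

/-! ### Spectra of real symmetric matrices -/

theorem Matrix.IsHermitian.exists_eigenvector_of_mem_spectrum {n : ℕ}
    {A : Matrix (Fin n) (Fin n) ℝ} (hA : A.IsHermitian) {l : ℝ} (hl : l ∈ spectrum ℝ A) :
    ∃ v : Fin n → ℝ, v ≠ 0 ∧ A.mulVec v = l • v := by
  rw [hA.spectrum_real_eq_range_eigenvalues] at hl
  obtain ⟨i, rfl⟩ := hl
  refine ⟨⇑(hA.eigenvectorBasis i), fun h => ?_, hA.mulVec_eigenvectorBasis i⟩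
  have h1 := hA.eigenvectorBasis.orthonormal.ne_zero i
  exact h1 (by ext j; exact congrFun h j)

theorem Matrix.IsHermitian.exists_isDiag_conj {n : ℕ}
    {A : Matrix (Fin n) (Fin n) ℝ} (hA : A.IsHermitian) :
    ∃ U : Matrix (Fin n) (Fin n) ℝ, U.transpose * U = 1 ∧ U * U.transpose = 1 ∧
      A = U * Matrix.diagonal hA.eigenvalues * U.transpose := by
  refine ⟨hA.eigenvectorUnitary, ?_, ?_, ?_⟩
  · simpa [Matrix.star_eq_conjTranspose] using
      Unitary.coe_star_mul_self hA.eigenvectorUnitary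
  · simpa [Matrix.star_eq_conjTranspose] using
      Unitary.coe_mul_star_self hA.eigenvectorUnitary
  · have := hA.spectral_theorem
    rw [Unitary.conjStarAlgAut_apply] at this
    simpa [Matrix.star_eq_conjTranspose, Function.comp_def] using this

theorem Matrix.IsHermitian.trace_pow_eq_sum_eigenvalues_pow {n : ℕ}
    {A : Matrix (Fin n) (Fin n) ℝ} (hA : A.IsHermitian) (m : ℕ) :
    (A ^ m).trace = ∑ i, hA.eigenvalues i ^ m := by
  obtain ⟨U, h1, h2, h3⟩ := hA.exists_isDiag_conj
  generalize hA.eigenvalues = e at h3 ⊢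
  have h : A ^ m = U * Matrix.diagonal e ^ m * U.transpose := by
    induction m with
    | zero => simp [h2]
    | succ m ih =>
      rw [pow_succ, ih]
      conv_lhs => rw [h3]
      rw [pow_succ]
      simp only [mul_assoc]
      rw [← mul_assoc U.transpose U, h1, one_mul]
  rw [h, Matrix.trace_mul_comm, ← mul_assoc, h1, one_mul, Matrix.diagonal_pow,
    Matrix.trace_diagonal]
  rfl

/-- In an orthonormal eigenbasis, eigenvalues all at distance at least `d` from `x` would force `‖(A
- x) v‖ ≥ d ‖v‖`. This turns approximate eigenvectors into nearby eigenvalues. -/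
theorem Matrix.IsHermitian.infDist_spectrum_lt {n : ℕ}
    {A : Matrix (Fin n) (Fin n) ℝ} (hA : A.IsHermitian) {x d : ℝ} (hd : 0 < d) (v : Fin n → ℝ)
    (hv : ∑ i, (A.mulVec v i - x * v i) ^ 2 < d ^ 2 * ∑ i, v i ^ 2) :
    Metric.infDist x (spectrum ℝ A) < d := by
  have hex : ∃ i, |hA.eigenvalues i - x| < d := by
    by_contra! hcon
    obtain ⟨U, h1, h2, h3⟩ := hA.exists_isDiag_conj
    have isom : ∀ w : Fin n → ℝ, ∑ i, (U.mulVec w i) ^ 2 = ∑ i, w i ^ 2 := by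
      intro w
      have : U.mulVec w ⬝ᵥ U.mulVec w = w ⬝ᵥ w := by
        rw [Matrix.dotProduct_mulVec, Matrix.vecMul_mulVec, h1, Matrix.vecMul_one]
      simpa [dotProduct, sq] using this
    set w := U.transpose.mulVec v with hw
    have hvw : v = U.mulVec w := by rw [hw, Matrix.mulVec_mulVec, h2, Matrix.one_mulVec]
    have hres : ∀ i, A.mulVec v i - x * v i =
        U.mulVec (fun j => (hA.eigenvalues j - x) * w j) i := by
      intro i
      have e1 : A.mulVec v = U.mulVec (fun j => hA.eigenvalues j * w j) := by
        conv_lhs => rw [h3]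
        rw [← Matrix.mulVec_mulVec, ← Matrix.mulVec_mulVec, ← hw]
        congr 1
        ext j; rw [Matrix.mulVec_diagonal]
      have e2 : x * v i = U.mulVec (fun j => x * w j) i := by
        rw [hvw]
        simp only [Matrix.mulVec, dotProduct, Finset.mul_sum]
        exact Finset.sum_congr rfl fun j _ => by ring
      rw [e1, e2, ← Pi.sub_apply, ← Matrix.mulVec_sub]
      congr 2
      ext j; simp [sub_mul]
    simp only [hres, isom] at hv
    rw [hvw, isom, Finset.mul_sum] at hv
    refine absurd hv (not_lt.mpr (Finset.sum_le_sum fun i _ => ?_))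
    rw [mul_pow]
    refine mul_le_mul_of_nonneg_right ?_ (sq_nonneg _)
    rw [← sq_abs (hA.eigenvalues i - x)]
    exact pow_le_pow_left₀ hd.le (hcon i) 2
  obtain ⟨i, hi⟩ := hex
  refine (Metric.infDist_le_dist_of_mem (hA.eigenvalues_mem_spectrum_real i)).trans_lt ?_
  rwa [dist_comm, Real.dist_eq]

/-! ### Quadratic form bounds -/

theorem sum_timeExtend_sq_le {n : ℕ} (v : Fin n → ℝ) :
    ∑ i : Fin n, timeExtend v i.val ^ 2 ≤ ∑ i, v i ^ 2 := by
  have h1 : ∑ i, v i ^ 2 = ∑ i : Fin n, timeExtend v (i.val + 1) ^ 2 := by simp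
  rw [h1, Fin.sum_univ_eq_sum_range (fun t => timeExtend v t ^ 2),
    Fin.sum_univ_eq_sum_range (fun t => timeExtend v (t + 1) ^ 2)]
  have h2 := Finset.sum_range_succ' (fun t => timeExtend v t ^ 2) n
  rw [Finset.sum_range_succ] at h2
  simp only [timeExtend_zero] at h2
  nlinarith [sq_nonneg (timeExtend v n)]

/-- Expand the square, use `2|v||u| ≤ v² + u²`, and use that the time shift is a contraction. The
hypothesis bounds the products instead of the coefficients, so that a large coefficient is harmless
where the vector vanishes. -/
theorem sum_arOperator_sq_le {n : ℕ} (a : ℕ → ℝ) (v : Fin n → ℝ) {r : ℝ} (hr : 0 ≤ r)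
    (h : ∀ i : Fin n, |a (i.val + 1) * timeExtend v i.val| ≤ r * |timeExtend v i.val|) :
    ∑ i, (arOperator a n).mulVec v i ^ 2 ≤ (1 + r) ^ 2 * ∑ i, v i ^ 2 := by
  have h1 : ∀ i : Fin n, (arOperator a n).mulVec v i ^ 2 ≤
      (1 + r) * v i ^ 2 + (r + r ^ 2) * timeExtend v i.val ^ 2 := by
    intro i
    rw [arOperator_mulVec]
    have hb := h i
    generalize a (i.val + 1) * timeExtend v i.val = b at hb
    generalize timeExtend v i.val = u at hb
    have e1 : |v i - b| ≤ |v i| + r * |u| := (abs_sub _ _).trans (by linarith)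
    calc (v i - b) ^ 2 = |v i - b| ^ 2 := (sq_abs _).symm
      _ ≤ (|v i| + r * |u|) ^ 2 := pow_le_pow_left₀ (abs_nonneg _) e1 2
      _ ≤ (1 + r) * |v i| ^ 2 + (r + r ^ 2) * |u| ^ 2 := by
        nlinarith [mul_nonneg hr (sq_nonneg (|v i| - |u|))]
      _ = _ := by rw [sq_abs, sq_abs]
  calc _ ≤ ∑ i : Fin n, ((1 + r) * v i ^ 2 + (r + r ^ 2) * timeExtend v i.val ^ 2) :=
        Finset.sum_le_sum fun i _ => h1 i
    _ = (1 + r) * ∑ i, v i ^ 2 + (r + r ^ 2) * ∑ i : Fin n, timeExtend v i.val ^ 2 := by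
        rw [Finset.sum_add_distrib, Finset.mul_sum, Finset.mul_sum]
    _ ≤ (1 + r) * ∑ i, v i ^ 2 + (r + r ^ 2) * ∑ i, v i ^ 2 := by
        have := sum_timeExtend_sq_le v
        gcongr
    _ = _ := by ring

theorem le_sum_arOperator_sq {n : ℕ} (a : ℕ → ℝ) (v : Fin n → ℝ) {r : ℝ} (hr : 0 ≤ r)
    (hr1 : r ≤ 1)
    (h : ∀ i : Fin n, |a (i.val + 1) * timeExtend v i.val| ≤ r * |timeExtend v i.val|) :
    (1 - r) ^ 2 * ∑ i, v i ^ 2 ≤ ∑ i, (arOperator a n).mulVec v i ^ 2 := by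
  have h1 : ∀ i : Fin n, (1 - r) * v i ^ 2 + (r ^ 2 - r) * timeExtend v i.val ^ 2 ≤
      (arOperator a n).mulVec v i ^ 2 := by
    intro i
    rw [arOperator_mulVec]
    have hb := h i
    generalize a (i.val + 1) * timeExtend v i.val = b at hb
    generalize timeExtend v i.val = u at hb
    have hb2 : b ^ 2 ≤ r ^ 2 * u ^ 2 := by
      rw [← sq_abs b, ← sq_abs u, ← mul_pow]
      exact pow_le_pow_left₀ (abs_nonneg _) hb 2
    rcases hr.eq_or_lt with rfl | hr0
    · have : b = 0 := by nlinarith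
      simp [this]
    -- After multiplication by `r`, and with `b² ≤ r² u²`, the difference is at least `(r v - b)²`.
    · have e : 0 ≤ r * ((v i - b) ^ 2 - ((1 - r) * v i ^ 2 + (r ^ 2 - r) * u ^ 2)) := by
        nlinarith [sq_nonneg (r * v i - b), mul_le_mul_of_nonneg_left hb2 (sub_nonneg.mpr hr1)]
      have := nonneg_of_mul_nonneg_right e hr0
      linarith
  calc (1 - r) ^ 2 * ∑ i, v i ^ 2
      = (1 - r) * ∑ i, v i ^ 2 + (r ^ 2 - r) * ∑ i, v i ^ 2 := by ring
    _ ≤ (1 - r) * ∑ i, v i ^ 2 + (r ^ 2 - r) * ∑ i : Fin n, timeExtend v i.val ^ 2 := by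
        have := mul_le_mul_of_nonpos_left (sum_timeExtend_sq_le v)
          (show r ^ 2 - r ≤ 0 by nlinarith)
        linarith
    _ = ∑ i : Fin n, ((1 - r) * v i ^ 2 + (r ^ 2 - r) * timeExtend v i.val ^ 2) := by
        rw [Finset.sum_add_distrib, Finset.mul_sum, Finset.mul_sum]
    _ ≤ _ := Finset.sum_le_sum fun i _ => h1 i

theorem dotProduct_arGram_mulVec {n : ℕ} (a : ℕ → ℝ) (v : Fin n → ℝ) :
    v ⬝ᵥ (arGram a n).mulVec v = ∑ i, (arOperator a n).mulVec v i ^ 2 := by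
  rw [arGram, ← Matrix.mulVec_mulVec, Matrix.dotProduct_mulVec, Matrix.vecMul_transpose]
  simp [dotProduct, sq]

theorem sum_sq_pos_of_ne_zero {n : ℕ} {v : Fin n → ℝ} (hv : v ≠ 0) : 0 < ∑ i, v i ^ 2 := by
  obtain ⟨i, hi⟩ := Function.ne_iff.mp hv
  exact Finset.sum_pos' (fun _ _ => sq_nonneg _) ⟨i, Finset.mem_univ _, by
    have : v i ≠ 0 := hi
    positivity⟩

theorem spectrum_arGram_eigenvector {n : ℕ} {a : ℕ → ℝ} {l : ℝ}
    (hl : l ∈ spectrum ℝ (arGram a n)) :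
    ∃ v : Fin n → ℝ, v ≠ 0 ∧ (arGram a n).mulVec v = l • v ∧
      ∑ i, (arOperator a n).mulVec v i ^ 2 = l * ∑ i, v i ^ 2 := by
  obtain ⟨v, hv, hl⟩ := (arGram_isHermitian a n).exists_eigenvector_of_mem_spectrum hl
  refine ⟨v, hv, hl, ?_⟩
  rw [← dotProduct_arGram_mulVec, hl, dotProduct_smul]
  simp [dotProduct, sq]

theorem spectrum_arGram_subset_upper {n : ℕ} {a : ℕ → ℝ} {r : ℝ} (hr : 0 ≤ r)
    (h : ∀ t, |a t| ≤ r) : spectrum ℝ (arGram a n) ⊆ Set.Icc 0 ((1 + r) ^ 2) := by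
  intro l hl
  obtain ⟨v, hv, -, hq⟩ := spectrum_arGram_eigenvector hl
  have hpos := sum_sq_pos_of_ne_zero hv
  have h1 := sum_arOperator_sq_le a v hr fun i => by
    rw [abs_mul]; exact mul_le_mul_of_nonneg_right (h _) (abs_nonneg _)
  have h0 : 0 ≤ ∑ i, (arOperator a n).mulVec v i ^ 2 := Finset.sum_nonneg fun _ _ => sq_nonneg _
  rw [hq] at h1 h0
  exact ⟨nonneg_of_mul_nonneg_left h0 hpos, le_of_mul_le_mul_right h1 hpos⟩

theorem spectrum_arGram_subset {n : ℕ} {a : ℕ → ℝ} {r : ℝ} (hr : 0 ≤ r) (hr1 : r ≤ 1)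
    (h : ∀ t, |a t| ≤ r) :
    spectrum ℝ (arGram a n) ⊆ Set.Icc ((1 - r) ^ 2) ((1 + r) ^ 2) := by
  intro l hl
  refine ⟨?_, (spectrum_arGram_subset_upper hr h hl).2⟩
  obtain ⟨v, hv, -, hq⟩ := spectrum_arGram_eigenvector hl
  have h1 := le_sum_arOperator_sq a v hr hr1 fun i => by
    rw [abs_mul]; exact mul_le_mul_of_nonneg_right (h _) (abs_nonneg _)
  rw [hq] at h1
  exact le_of_mul_le_mul_right h1 (sum_sq_pos_of_ne_zero hv)

/-- Two eigenvectors for distinct eigenvalues combine to a vector that vanishes at a prescribed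
time. -/
theorem exists_combination_of_two_eigenvalues {n : ℕ} {a : ℕ → ℝ} {l m : ℝ}
    (hl : l ∈ spectrum ℝ (arGram a n)) (hm : m ∈ spectrum ℝ (arGram a n)) (hlm : l ≠ m)
    (τ : ℕ) :
    ∃ (v : Fin n → ℝ) (p q : ℝ), 0 ≤ p ∧ 0 ≤ q ∧ 0 < p + q ∧ timeExtend v τ = 0 ∧
      ∑ i, v i ^ 2 = p + q ∧ ∑ i, (arOperator a n).mulVec v i ^ 2 = l * p + m * q := by
  obtain ⟨u, hu, hul, huq⟩ := spectrum_arGram_eigenvector hl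
  obtain ⟨w, hw, hwm, hwq⟩ := spectrum_arGram_eigenvector hm
  have hu0 := sum_sq_pos_of_ne_zero hu
  have hw0 := sum_sq_pos_of_ne_zero hw
  -- Otherwise `y ≠ 0`, so `x u - y w` carries positive weight `y² ‖w‖²` on `w`; orthogonality makes
  -- the two weights add up.
  by_cases h0 : timeExtend u τ = 0
  · exact ⟨u, ∑ i, u i ^ 2, 0, hu0.le, le_rfl, by linarith, h0, by ring, by rw [huq]; ring⟩
  set x := timeExtend w τ
  set y := timeExtend u τ with hy
  have horth : u ⬝ᵥ w = 0 := by
    have h1 : u ⬝ᵥ (arGram a n).mulVec w = (arGram a n).mulVec u ⬝ᵥ w := by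
      rw [Matrix.dotProduct_mulVec, ← Matrix.mulVec_transpose]
      have := (arGram_isHermitian a n).eq
      rw [Matrix.conjTranspose_eq_transpose_of_trivial] at this
      rw [this]
    rw [hul, hwm, dotProduct_smul, smul_dotProduct, smul_eq_mul, smul_eq_mul] at h1
    have : (m - l) * (u ⬝ᵥ w) = 0 := by linarith
    exact (mul_eq_zero.mp this).resolve_left (sub_ne_zero.mpr hlm.symm)
  have huu : u ⬝ᵥ u = ∑ i, u i ^ 2 := by simp [dotProduct, sq]
  have hww : w ⬝ᵥ w = ∑ i, w i ^ 2 := by simp [dotProduct, sq]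
  have horth' : w ⬝ᵥ u = 0 := by rw [dotProduct_comm, horth]
  refine ⟨x • u - y • w, x ^ 2 * ∑ i, u i ^ 2, y ^ 2 * ∑ i, w i ^ 2, by positivity,
    by positivity, by positivity, ?_, ?_, ?_⟩
  · have : timeExtend (x • u - y • w) τ = x * timeExtend u τ - y * timeExtend w τ := by
      cases τ with
      | zero => simp
      | succ t => by_cases h : t < n <;> simp [timeExtend, h]
    rw [this, ← hy]; ring
  · have : ∑ i, (x • u - y • w) i ^ 2 = (x • u - y • w) ⬝ᵥ (x • u - y • w) := by
      simp [dotProduct, sq]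
    rw [this]
    simp only [sub_dotProduct, dotProduct_sub, smul_dotProduct, dotProduct_smul, horth, horth',
      huu, hww, smul_eq_mul]
    ring
  · rw [← dotProduct_arGram_mulVec, Matrix.mulVec_sub, Matrix.mulVec_smul, Matrix.mulVec_smul,
      hul, hwm]
    simp only [sub_dotProduct, dotProduct_sub, smul_dotProduct, dotProduct_smul, horth, horth',
      huu, hww, smul_eq_mul]
    ring

/-! ### Moments of the spectral distribution -/

theorem arGram_mul_apply (a : ℕ → ℝ) {n : ℕ} (M : Matrix (Fin n) (Fin n) ℝ) (i j : Fin n) :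
    (arGram a n * M) i j =
      (M i j - a (i.val + 1) * timeExtend (fun l => M l j) i.val) -
        if i.val + 1 < n then
          a (i.val + 2) * (timeExtend (fun l => M l j) (i.val + 2) - a (i.val + 2) * M i j)
        else 0 := by
  have := sum_arGram_row a i (timeExtend fun l => M l j) rfl
  simpa [Matrix.mul_apply] using this

theorem abs_arGram_pow_apply_le {a : ℕ → ℝ} {r : ℝ} (hr : 0 ≤ r) (h : ∀ t, |a t| ≤ r)
    {n : ℕ} (m : ℕ) (i j : Fin n) : |(arGram a n ^ m) i j| ≤ ((1 + r) ^ 2) ^ m := by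
  induction m generalizing i with
  | zero =>
    rw [pow_zero, pow_zero, Matrix.one_apply]
    split_ifs <;> simp
  | succ m ih =>
    rw [pow_succ', pow_succ', arGram_mul_apply]
    set K := ((1 + r) ^ 2) ^ m
    have hK : 0 ≤ K := by positivity
    have hg : ∀ t, |timeExtend (fun l => (arGram a n ^ m) l j) t| ≤ K := by
      intro t
      cases t with
      | zero => simpa using hK
      | succ t =>
        simp only [timeExtend]
        split_ifs
        · exact ih _
        · simpa using hK
    have key : ∀ t x y, |x| ≤ K → |y| ≤ K → |x - a t * y| ≤ (1 + r) * K := by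
      intro t x y hx hy
      calc |x - a t * y| ≤ |x| + |a t * y| := abs_sub _ _
        _ = |x| + |a t| * |y| := by rw [abs_mul]
        _ ≤ K + r * K := add_le_add hx (mul_le_mul (h t) hy (abs_nonneg _) hr)
        _ = _ := by ring
    calc _ ≤ |(arGram a n ^ m) i j - a (i.val + 1) *
              timeExtend (fun l => (arGram a n ^ m) l j) i.val| + _ := abs_sub _ _
      _ ≤ (1 + r) * K + r * ((1 + r) * K) := by
        refine add_le_add (key _ _ _ (ih i) (hg _)) ?_
        split_ifs
        · rw [abs_mul]
          exact mul_le_mul (h _) (key _ _ _ (hg _) (ih i)) (abs_nonneg _) hr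
        · rw [abs_zero]; positivity
      _ = _ := by ring

/-- The `d`-th Fourier coefficient of the `m`-th power of the symbol `1 + ρ² - 2ρ cos θ`. -/
noncomputable def symbolCoeff (ρ : ℝ) (m : ℕ) (d : ℤ) : ℝ :=
  (2 * Real.pi)⁻¹ *
    ∫ θ in (0)..(2 * Real.pi), Real.cos (d * θ) * (1 + ρ ^ 2 - 2 * ρ * Real.cos θ) ^ m

theorem symbolCoeff_zero (ρ : ℝ) (d : ℤ) : symbolCoeff ρ 0 d = if d = 0 then 1 else 0 := by
  have hpi := Real.pi_pos
  unfold symbolCoeff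
  split_ifs with hd
  · subst hd
    simp
    field_simp
  · have hd' : (d : ℝ) ≠ 0 := by exact_mod_cast hd
    simp only [pow_zero, mul_one]
    rw [intervalIntegral.integral_comp_mul_left (fun x => Real.cos x) hd', integral_cos]
    have : (d : ℝ) * (2 * Real.pi) = ((2 * d : ℤ) : ℝ) * Real.pi := by push_cast; ring
    rw [this, Real.sin_int_mul_pi]
    simp

/-- From `2 cos θ cos dθ = cos (d - 1)θ + cos (d + 1)θ`; this is the recurrence that an unperturbed
interior row of the Gram matrix satisfies. -/
theorem symbolCoeff_succ (ρ : ℝ) (m : ℕ) (d : ℤ) :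
    symbolCoeff ρ (m + 1) d =
      (1 + ρ ^ 2) * symbolCoeff ρ m d - ρ * symbolCoeff ρ m (d - 1) -
        ρ * symbolCoeff ρ m (d + 1) := by
  unfold symbolCoeff
  have hi : ∀ e : ℤ, IntervalIntegrable
      (fun θ => Real.cos (e * θ) * (1 + ρ ^ 2 - 2 * ρ * Real.cos θ) ^ m) volume
      0 (2 * Real.pi) := fun e => Continuous.intervalIntegrable (by fun_prop) _ _
  have h : ∀ θ : ℝ, Real.cos (d * θ) * (1 + ρ ^ 2 - 2 * ρ * Real.cos θ) ^ (m + 1) =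
      (1 + ρ ^ 2) * (Real.cos (d * θ) * (1 + ρ ^ 2 - 2 * ρ * Real.cos θ) ^ m) -
      ρ * (Real.cos ((d - 1 : ℤ) * θ) * (1 + ρ ^ 2 - 2 * ρ * Real.cos θ) ^ m) -
      ρ * (Real.cos ((d + 1 : ℤ) * θ) * (1 + ρ ^ 2 - 2 * ρ * Real.cos θ) ^ m) := by
    intro θ
    push_cast
    rw [show ((d : ℝ) - 1) * θ = d * θ - θ by ring, show ((d : ℝ) + 1) * θ = d * θ + θ by ring,
      Real.cos_sub, Real.cos_add]
    ring
  simp only [h]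
  rw [intervalIntegral.integral_sub (((hi d).const_mul _).sub ((hi _).const_mul _))
    ((hi _).const_mul _), intervalIntegral.integral_sub ((hi d).const_mul _)
    ((hi _).const_mul _), intervalIntegral.integral_const_mul,
    intervalIntegral.integral_const_mul, intervalIntegral.integral_const_mul]
  ring

/-- Each multiplication looks one row further on either side. The hypotheses keep that window away
from both ends and from the two rows that involve the coefficient at time `k`. -/
theorem arGram_pow_apply_eq_symbolCoeff (ρ ε : ℝ) (k : ℕ) {n : ℕ} (m : ℕ) (i j : Fin n)
    (h1 : m ≤ i.val) (h2 : i.val + m < n) (h3 : i.val + m + 1 < k ∨ k + m ≤ i.val + 1) :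
    (arGram (scmCoeff ρ ε k) n ^ m) i j = symbolCoeff ρ m ((i.val : ℤ) - j.val) := by
  induction m generalizing i with
  | zero =>
    rw [pow_zero, symbolCoeff_zero, Matrix.one_apply]
    congr 1
    rw [Fin.ext_iff, eq_iff_iff]
    omega
  | succ m ih =>
    rw [pow_succ', arGram_mul_apply, symbolCoeff_succ]
    have e1 : scmCoeff ρ ε k (i.val + 1) = ρ := by
      simp [scmCoeff, show i.val + 1 ≠ k by omega]
    have e2 : scmCoeff ρ ε k (i.val + 2) = ρ := by
      simp [scmCoeff, show i.val + 2 ≠ k by omega]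
    have hm : (arGram (scmCoeff ρ ε k) n ^ m) i j = symbolCoeff ρ m ((i.val : ℤ) - j.val) :=
      ih i (by omega) (by omega) (by omega)
    have hp : timeExtend (fun l => (arGram (scmCoeff ρ ε k) n ^ m) l j) i.val =
        symbolCoeff ρ m ((i.val : ℤ) - j.val - 1) := by
      obtain ⟨t, ht⟩ : ∃ t, i.val = t + 1 := ⟨i.val - 1, by omega⟩
      rw [ht, show ((t + 1 : ℕ) : ℤ) - j.val - 1 = (t : ℤ) - j.val by push_cast; ring]
      simp only [timeExtend, show t < n by omega, dif_pos]
      exact ih ⟨t, by omega⟩ (by simp; omega) (by simp; omega) (by simp; omega)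
    have hs : timeExtend (fun l => (arGram (scmCoeff ρ ε k) n ^ m) l j) (i.val + 2) =
        symbolCoeff ρ m ((i.val : ℤ) - j.val + 1) := by
      rw [show (i.val : ℤ) - j.val + 1 = ((i.val + 1 : ℕ) : ℤ) - j.val by push_cast; ring]
      simp only [timeExtend, show i.val + 1 < n by omega, dif_pos]
      exact ih ⟨i.val + 1, by omega⟩ (by simp; omega) (by simp; omega) (by simp; omega)
    rw [if_pos (by omega), e1, e2, hp, hs, hm]
    ring

theorem abs_scmCoeff_le (ρ ε : ℝ) (k t : ℕ) : |scmCoeff ρ ε k t| ≤ |ρ| + |ε| := by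
  unfold scmCoeff
  refine (abs_add_le _ _).trans (add_le_add le_rfl ?_)
  split_ifs <;> simp

theorem abs_trace_arGram_pow_sub_le (ρ ε : ℝ) (k n m : ℕ) :
    |(arGram (scmCoeff ρ ε k) n ^ m).trace - n * symbolCoeff ρ m 0| ≤
      4 * m * (((1 + (|ρ| + |ε|)) ^ 2) ^ m + |symbolCoeff ρ m 0|) := by
  set C := ((1 + (|ρ| + |ε|)) ^ 2) ^ m + |symbolCoeff ρ m 0|
  have hC : 0 ≤ C := by positivity
  -- Rows within reach of the first time, the last time, or the break: at most `m + m + 2m` of them.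
  set bad : Finset ℕ :=
    Finset.range m ∪ Finset.Ico (n - m) n ∪ Finset.Ico (k - m - 1) (k - 1 + m)
  have hcard : bad.card ≤ 4 * m := by
    refine (Finset.card_union_le _ _).trans ?_
    have := Finset.card_union_le (Finset.range m) (Finset.Ico (n - m) n)
    simp only [Finset.card_range, Nat.card_Ico] at this ⊢
    omega
  have h1 : (arGram (scmCoeff ρ ε k) n ^ m).trace - n * symbolCoeff ρ m 0 =
      ∑ i : Fin n, ((arGram (scmCoeff ρ ε k) n ^ m) i i - symbolCoeff ρ m 0) := by
    rw [Finset.sum_sub_distrib]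
    simp [Matrix.trace]
  have h2 : ∀ i : Fin n, |(arGram (scmCoeff ρ ε k) n ^ m) i i - symbolCoeff ρ m 0| ≤
      if i.val ∈ bad then C else 0 := by
    intro i
    split_ifs with hb
    · exact (abs_sub _ _).trans (add_le_add
        (abs_arGram_pow_apply_le (by positivity) (abs_scmCoeff_le ρ ε k) m i i) le_rfl)
    · simp only [bad, Finset.mem_union, Finset.mem_range, Finset.mem_Ico, not_or, not_and,
        not_lt] at hb
      rw [arGram_pow_apply_eq_symbolCoeff ρ ε k m i i (by omega) (by omega) (by omega)]
      simp
  calc _ ≤ ∑ i : Fin n, |(arGram (scmCoeff ρ ε k) n ^ m) i i - symbolCoeff ρ m 0| := by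
        rw [h1]; exact Finset.abs_sum_le_sum_abs _ _
    _ ≤ ∑ i : Fin n, if i.val ∈ bad then C else 0 := Finset.sum_le_sum fun i _ => h2 i
    _ = ∑ t ∈ Finset.range n, if t ∈ bad then C else 0 :=
        Fin.sum_univ_eq_sum_range (fun t => if t ∈ bad then C else 0) n
    _ = ((Finset.range n).filter (· ∈ bad)).card * C := by
        rw [← Finset.sum_filter, Finset.sum_const, nsmul_eq_mul]
    _ ≤ (4 * m : ℕ) * C := by
        refine mul_le_mul_of_nonneg_right ?_ hC
        refine Nat.cast_le.mpr ((Finset.card_le_card ?_).trans hcard)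
        intro t ht
        exact (Finset.mem_filter.mp ht).2
    _ = _ := by push_cast; ring

theorem tendsto_trace_arGram_pow_div (ρ ε : ℝ) (k : ℕ → ℕ) (m : ℕ) :
    Tendsto (fun n : ℕ => (n : ℝ)⁻¹ * (arGram (scmCoeff ρ ε (k n)) n ^ m).trace) atTop
      (𝓝 (symbolCoeff ρ m 0)) := by
  set D := 4 * m * (((1 + (|ρ| + |ε|)) ^ 2) ^ m + |symbolCoeff ρ m 0|)
  have hD : Tendsto (fun n : ℕ => (n : ℝ)⁻¹ * D) atTop (𝓝 0) := by
    simpa using tendsto_inv_atTop_nhds_zero_nat.mul_const D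
  rw [tendsto_iff_norm_sub_tendsto_zero]
  refine squeeze_zero' (Eventually.of_forall fun _ => norm_nonneg _) ?_ hD
  filter_upwards [eventually_ge_atTop 1] with n hn
  have hn0 : (n : ℝ) ≠ 0 := by positivity
  have : (n : ℝ)⁻¹ * (arGram (scmCoeff ρ ε (k n)) n ^ m).trace - symbolCoeff ρ m 0 =
      (n : ℝ)⁻¹ * ((arGram (scmCoeff ρ ε (k n)) n ^ m).trace - n * symbolCoeff ρ m 0) := by
    field_simp
  rw [this, norm_mul, Real.norm_eq_abs, Real.norm_eq_abs, abs_of_nonneg (by positivity)]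
  exact mul_le_mul_of_nonneg_left (abs_trace_arGram_pow_sub_le ρ ε (k n) n m) (by positivity)

/-! ### The limit law and its support -/

theorem integral_esd {n : ℕ} (A : Matrix (Fin n) (Fin n) ℝ) (hA : A.IsHermitian) (f : ℝ → ℝ) :
    ∫ x, f x ∂(esd A hA) = (n : ℝ)⁻¹ * ∑ i, f (hA.eigenvalues i) := by
  rw [esd, integral_smul_measure, integral_finsetSum_measure fun i _ => integrable_dirac (by simp)]
  simp

theorem integral_muRho (ρ : ℝ) {f : ℝ → ℝ} (hf : Continuous f) :
    ∫ x, f x ∂(muRho ρ) =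
      (2 * Real.pi)⁻¹ * ∫ θ in (0)..(2 * Real.pi), f (1 + ρ ^ 2 - 2 * ρ * Real.cos θ) := by
  have hpi := Real.pi_pos
  rw [muRho, integral_map (by fun_prop) hf.aestronglyMeasurable, integral_smul_measure,
    ENNReal.toReal_ofReal (by positivity), intervalIntegral.integral_of_le (by positivity)]
  rfl

theorem symbol_mem_Icc (ρ θ : ℝ) :
    1 + ρ ^ 2 - 2 * ρ * Real.cos θ ∈ Set.Icc (aBound ρ) (bBound ρ) := by
  have h : |ρ * Real.cos θ| ≤ |ρ| := by
    rw [abs_mul]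
    exact mul_le_of_le_one_right (abs_nonneg _) (Real.abs_cos_le_one θ)
  rw [abs_le] at h
  have := sq_abs ρ
  constructor <;> simp only [aBound, bBound] <;> nlinarith

theorem support_muRho {ρ : ℝ} (hρ0 : ρ ≠ 0) :
    (muRho ρ).support = Set.Icc (aBound ρ) (bBound ρ) := by
  have hpi := Real.pi_pos
  apply Set.Subset.antisymm
  · refine Measure.support_subset_of_isClosed isClosed_Icc ?_
    refine (ae_map_iff (by fun_prop) measurableSet_Icc).mpr (Eventually.of_forall fun θ => ?_)
    exact symbol_mem_Icc ρ θ
  · intro x hx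
    rw [Measure.mem_support_iff_forall]
    intro U hU
    obtain ⟨V, hVU, hV, hxV⟩ := mem_nhds_iff.mp hU
    refine lt_of_lt_of_le ?_ (measure_mono hVU)
    rw [muRho, Measure.map_apply (by fun_prop) hV.measurableSet, Measure.smul_apply, smul_eq_mul]
    set f : ℝ → ℝ := fun θ => 1 + ρ ^ 2 - 2 * ρ * Real.cos θ with hf
    have hfV : IsOpen (f ⁻¹' V) := hV.preimage (by fun_prop)
    refine ENNReal.mul_pos (by simpa using hpi) (ne_of_gt ?_)
    rw [Measure.restrict_apply hfV.measurableSet]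
    set y := (1 + ρ ^ 2 - x) / (2 * ρ) with hy
    have hy1 : |y| ≤ 1 := by
      rw [hy, abs_div, div_le_one (by positivity), abs_mul, abs_two, abs_le]
      have := sq_abs ρ
      simp only [aBound, bBound, Set.mem_Icc] at hx
      constructor <;> nlinarith
    rw [abs_le] at hy1
    have hfx : f (Real.arccos y) = x := by
      simp only [hf]
      rw [Real.cos_arccos hy1.1 hy1.2, hy]
      field_simp
      ring
    -- `arccos y` can be the end point `0`, so only membership in the closure is available; an open
    -- preimage still meets the open interval.
    have hcl : Real.arccos y ∈ closure (Set.Ioo 0 (2 * Real.pi)) := by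
      rw [closure_Ioo (by positivity)]
      exact ⟨Real.arccos_nonneg y, (Real.arccos_le_pi y).trans (by linarith)⟩
    have hne := mem_closure_iff.mp hcl _ hfV (by rw [Set.mem_preimage, hfx]; exact hxV)
    exact ((hfV.inter isOpen_Ioo).measure_pos volume hne).trans_le
      (measure_mono (Set.inter_subset_inter_right _ Set.Ioo_subset_Ioc_self))

theorem tendsto_eigenvalue_average_polynomial (ρ ε : ℝ) (k : ℕ → ℕ) (p : Polynomial ℝ) :
    Tendsto (fun n : ℕ => (n : ℝ)⁻¹ *
        ∑ i, p.eval ((arGram_isHermitian (scmCoeff ρ ε (k n)) n).eigenvalues i)) atTop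
      (𝓝 ((2 * Real.pi)⁻¹ *
        ∫ θ in (0)..(2 * Real.pi), p.eval (1 + ρ ^ 2 - 2 * ρ * Real.cos θ))) := by
  induction p using Polynomial.induction_on' with
  | add p q hp hq =>
    have := hp.add hq
    have hi : ∀ p : Polynomial ℝ, IntervalIntegrable
        (fun θ => p.eval (1 + ρ ^ 2 - 2 * ρ * Real.cos θ)) volume 0 (2 * Real.pi) := fun p =>
      (p.continuous.comp (by fun_prop)).intervalIntegrable _ _
    simp only [Polynomial.eval_add, Finset.sum_add_distrib, mul_add]
    rwa [intervalIntegral.integral_add (hi p) (hi q), mul_add]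
  | monomial m c =>
    have := (tendsto_trace_arGram_pow_div ρ ε k m).const_mul c
    simp only [Polynomial.eval_monomial, intervalIntegral.integral_const_mul, ← Finset.mul_sum]
    simp only [symbolCoeff, Int.cast_zero, zero_mul, Real.cos_zero, one_mul] at this
    convert this using 2 with n
    · rw [(arGram_isHermitian (scmCoeff ρ ε (k n)) n).trace_pow_eq_sum_eigenvalues_pow]
      ring
    · ring

theorem hasASD_arGram (ρ ε : ℝ) (k : ℕ → ℕ) :
    HasASD (fun n => arGram (scmCoeff ρ ε (k n)) n) (muRho ρ) := by
  have hpi := Real.pi_pos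
  refine ⟨fun n => arGram_isHermitian _ n, fun f => ?_⟩
  -- `[0, K]` contains every spectrum and the range of the symbol, so one polynomial serves for both
  -- sides.
  set K := (1 + (|ρ| + |ε|)) ^ 2 with hK
  simp only [integral_esd, integral_muRho ρ f.continuous]
  rw [Metric.tendsto_atTop]
  intro δ hδ
  obtain ⟨p, hp⟩ := exists_polynomial_near_of_continuousOn 0 K f f.continuous.continuousOn
    (δ / 3) (by positivity)
  obtain ⟨N, hN⟩ := Metric.tendsto_atTop.mp (tendsto_eigenvalue_average_polynomial ρ ε k p)
    (δ / 3) (by positivity)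
  refine ⟨N, fun n hn => ?_⟩
  have h1 := hN n hn
  rw [Real.dist_eq] at h1 ⊢
  have hI : |(2 * Real.pi)⁻¹ * (∫ θ in (0)..(2 * Real.pi),
        p.eval (1 + ρ ^ 2 - 2 * ρ * Real.cos θ)) - (2 * Real.pi)⁻¹ *
        ∫ θ in (0)..(2 * Real.pi), f (1 + ρ ^ 2 - 2 * ρ * Real.cos θ)| ≤ δ / 3 := by
    have hc : Continuous fun θ => 1 + ρ ^ 2 - 2 * ρ * Real.cos θ := by fun_prop
    have hi1 := (p.continuous.comp hc).intervalIntegrable (μ := volume) 0 (2 * Real.pi)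
    have hi2 := (f.continuous.comp hc).intervalIntegrable (μ := volume) 0 (2 * Real.pi)
    simp only [Function.comp_def] at hi1 hi2
    rw [← mul_sub, ← intervalIntegral.integral_sub hi1 hi2, abs_mul,
      abs_of_nonneg (by positivity)]
    have := intervalIntegral.norm_integral_le_of_norm_le_const (a := 0) (b := 2 * Real.pi)
      (C := δ / 3)
      (f := fun θ => p.eval (1 + ρ ^ 2 - 2 * ρ * Real.cos θ) -
        f (1 + ρ ^ 2 - 2 * ρ * Real.cos θ)) fun θ _ => by
        rw [Real.norm_eq_abs]
        refine (hp _ ?_).le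
        have h := symbol_mem_Icc ρ θ
        refine ⟨le_trans (sq_nonneg _) h.1, h.2.trans ?_⟩
        simp only [bBound, hK]
        have := abs_nonneg ε
        gcongr
        linarith
    rw [Real.norm_eq_abs, sub_zero, abs_of_pos (by positivity : 0 < 2 * Real.pi)] at this
    calc _ ≤ (2 * Real.pi)⁻¹ * (δ / 3 * (2 * Real.pi)) :=
          mul_le_mul_of_nonneg_left this (by positivity)
      _ = _ := by field_simp
  set l := (arGram_isHermitian (scmCoeff ρ ε (k n)) n).eigenvalues with hl
  have hS : |(n : ℝ)⁻¹ * ∑ i, f (l i) - (n : ℝ)⁻¹ * ∑ i, p.eval (l i)| ≤ δ / 3 := by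
    rw [← mul_sub, ← Finset.sum_sub_distrib, abs_mul, abs_of_nonneg (by positivity)]
    have : |∑ i, (f (l i) - p.eval (l i))| ≤ ∑ i : Fin n, δ / 3 := by
      refine (Finset.abs_sum_le_sum_abs _ _).trans (Finset.sum_le_sum fun i _ => ?_)
      rw [abs_sub_comm]
      exact (hp _ (spectrum_arGram_subset_upper (by positivity) (abs_scmCoeff_le ρ ε (k n))
        ((arGram_isHermitian _ n).eigenvalues_mem_spectrum_real i))).le
    rw [Finset.sum_const, Finset.card_univ, Fintype.card_fin, nsmul_eq_mul] at this
    refine (mul_le_mul_of_nonneg_left this (by positivity)).trans ?_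
    rw [← mul_assoc]
    exact mul_le_of_le_one_left (by positivity) (inv_mul_le_one)
  rw [abs_lt] at h1 ⊢
  rw [abs_le] at hI hS
  constructor <;> linarith [h1.1, h1.2, hI.1, hI.2, hS.1, hS.2]

/-! ### Confinement and uniqueness of outliers -/

theorem eventually_exists_spectrum_near {A : (n : ℕ) → Matrix (Fin n) (Fin n) ℝ}
    (hA : ∀ n, (A n).IsHermitian) {x d : ℝ} (hd : 0 < d)
    (hx : Tendsto (fun n => Metric.infDist x (spectrum ℝ (A n))) atTop (𝓝 0)) :
    ∀ᶠ n in atTop, ∃ l ∈ spectrum ℝ (A n), |x - l| < d := by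
  -- `n ≥ 1` makes the spectrum nonempty; `Metric.infDist` to the empty set is `0` by convention.
  filter_upwards [hx.eventually_lt_const hd, eventually_ge_atTop 1] with n hn h1
  have hne : (spectrum ℝ (A n)).Nonempty :=
    ⟨_, (hA n).eigenvalues_mem_spectrum_real ⟨0, h1⟩⟩
  exact (Metric.infDist_lt_iff hne).mp hn

theorem mem_Icc_of_tendsto_infDist_spectrum {A : (n : ℕ) → Matrix (Fin n) (Fin n) ℝ}
    (hA : ∀ n, (A n).IsHermitian) {x a b : ℝ} (hs : ∀ n, spectrum ℝ (A n) ⊆ Set.Icc a b)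
    (hx : Tendsto (fun n => Metric.infDist x (spectrum ℝ (A n))) atTop (𝓝 0)) :
    x ∈ Set.Icc a b := by
  refine isClosed_Icc.closure_subset (Metric.mem_closure_iff.mpr fun d hd => ?_)
  obtain ⟨n, l, hl, hxl⟩ := (eventually_exists_spectrum_near hA hd hx).exists
  exact ⟨l, hs n hl, hxl⟩

theorem abs_scmCoeff_le_of_abs_add_le {ρ ε : ℝ} (h : |ρ + ε| ≤ |ρ|) (k t : ℕ) :
    |scmCoeff ρ ε k t| ≤ |ρ| := by
  unfold scmCoeff
  split_ifs
  · exact h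
  · simp

theorem abs_scmCoeff_mul_timeExtend_le (ρ ε : ℝ) {n k : ℕ} {v : Fin n → ℝ}
    (hv : timeExtend v (k - 1) = 0) (i : Fin n) :
    |scmCoeff ρ ε k (i.val + 1) * timeExtend v i.val| ≤ |ρ| * |timeExtend v i.val| := by
  by_cases h : i.val + 1 = k
  · have : i.val = k - 1 := by omega
    rw [this, hv]
    simp
  · simp [scmCoeff, h, abs_mul]

/-- Two distinct eigenvalues below the bound would give a combination of eigenvectors that vanishes
at time `k - 1`. It does not feel the break, so its quadratic form obeys the bound for constant `ρ`,
a contradiction. -/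
theorem eq_of_spectrum_lt_aBound {ρ ε : ℝ} (hρ : |ρ| ≤ 1) {n k : ℕ} {l m : ℝ}
    (hl : l ∈ spectrum ℝ (arGram (scmCoeff ρ ε k) n))
    (hm : m ∈ spectrum ℝ (arGram (scmCoeff ρ ε k) n)) (hla : l < aBound ρ) (hma : m < aBound ρ) :
    l = m := by
  by_contra hlm
  obtain ⟨v, p, q, hp, hq, hpq, hv, h1, h2⟩ :=
    exists_combination_of_two_eigenvalues hl hm hlm (k - 1)
  have h := le_sum_arOperator_sq (scmCoeff ρ ε k) v (abs_nonneg ρ) hρ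
    (abs_scmCoeff_mul_timeExtend_le ρ ε hv)
  rw [h1, h2] at h
  simp only [aBound] at hla hma
  rcases hp.eq_or_lt with rfl | hp0
  · nlinarith
  · nlinarith

theorem eq_of_bBound_lt_spectrum {ρ ε : ℝ} {n k : ℕ} {l m : ℝ}
    (hl : l ∈ spectrum ℝ (arGram (scmCoeff ρ ε k) n))
    (hm : m ∈ spectrum ℝ (arGram (scmCoeff ρ ε k) n)) (hlb : bBound ρ < l) (hmb : bBound ρ < m) :
    l = m := by
  by_contra hlm
  obtain ⟨v, p, q, hp, hq, hpq, hv, h1, h2⟩ :=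
    exists_combination_of_two_eigenvalues hl hm hlm (k - 1)
  have h := sum_arOperator_sq_le (scmCoeff ρ ε k) v (abs_nonneg ρ)
    (abs_scmCoeff_mul_timeExtend_le ρ ε hv)
  rw [h1, h2] at h
  simp only [bBound] at hlb hmb
  rcases hp.eq_or_lt with rfl | hp0
  · nlinarith
  · nlinarith

theorem eq_of_tendsto_infDist_spectrum {A : (n : ℕ) → Matrix (Fin n) (Fin n) ℝ}
    (hA : ∀ n, (A n).IsHermitian) {S : Set ℝ} (hS : IsOpen S)
    (hu : ∀ n, ∀ l ∈ spectrum ℝ (A n), ∀ m ∈ spectrum ℝ (A n), l ∈ S → m ∈ S → l = m)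
    {x y : ℝ} (hxS : x ∈ S) (hyS : y ∈ S)
    (hx : Tendsto (fun n => Metric.infDist x (spectrum ℝ (A n))) atTop (𝓝 0))
    (hy : Tendsto (fun n => Metric.infDist y (spectrum ℝ (A n))) atTop (𝓝 0)) : x = y := by
  refine eq_of_forall_dist_le fun d hd => ?_
  obtain ⟨e1, he1, hb1⟩ := Metric.isOpen_iff.mp hS x hxS
  obtain ⟨e2, he2, hb2⟩ := Metric.isOpen_iff.mp hS y hyS
  have h1 := eventually_exists_spectrum_near hA
    (lt_min he1 (half_pos hd)) hx
  have h2 := eventually_exists_spectrum_near hA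
    (lt_min he2 (half_pos hd)) hy
  obtain ⟨n, ⟨l, hl, hxl⟩, ⟨m, hm, hym⟩⟩ := (h1.and h2).exists
  rw [lt_min_iff] at hxl hym
  have hlm : l = m := hu n l hl m hm
    (hb1 (by rw [Metric.mem_ball, dist_comm]; exact hxl.1))
    (hb2 (by rw [Metric.mem_ball, dist_comm]; exact hym.1))
  subst hlm
  calc dist x y ≤ dist x l + dist y l := dist_triangle_right x y l
    _ ≤ d / 2 + d / 2 := add_le_add hxl.2.le hym.2.le
    _ = d := by ring

/-! ### Modes localized at the break -/

/-- A function decaying geometrically on both sides of the break point `k`. -/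
def breakMode (ρ ε q : ℝ) (k t : ℕ) : ℝ :=
  if t < k then ρ * q ^ (k - 1 - t) else (ρ + ε) * q ^ (t - k + 1)

/-- Away from the break, `q ^ t` and `q ^ (-t)` both solve the recurrence with eigenvalue
`spectralMap ρ q`. The amplitudes `ρ` and `ρ + ε` settle the row at time `k`; the row at time `k -
1` is then the quadratic equation for `q`. -/
theorem breakMode_eigen {ρ ε q : ℝ} (hq0 : q ≠ 0)
    (hq : -(ε + ρ) ^ 2 * q ^ 2 + ε * ρ * (ε + 2 * ρ) * q + ρ ^ 2 = 0) {k : ℕ} (hk : 2 ≤ k)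
    (t : ℕ) :
    (1 + scmCoeff ρ ε k (t + 2) ^ 2) * breakMode ρ ε q k (t + 1) -
      scmCoeff ρ ε k (t + 1) * breakMode ρ ε q k t -
      scmCoeff ρ ε k (t + 2) * breakMode ρ ε q k (t + 2) =
    spectralMap ρ q * breakMode ρ ε q k (t + 1) := by
  have hx : spectralMap ρ q * q = (1 + ρ ^ 2) * q - ρ * q ^ 2 - ρ := by
    unfold spectralMap
    field_simp
    ring
  generalize spectralMap ρ q = x at hx
  rcases lt_or_ge (t + 2) k with h | h
  · obtain ⟨e, rfl⟩ : ∃ e, k = t + 3 + e := ⟨k - (t + 3), by omega⟩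
    have a1 : scmCoeff ρ ε (t + 3 + e) (t + 2) = ρ := by
      simp [scmCoeff, show t + 2 ≠ t + 3 + e by omega]
    have a2 : scmCoeff ρ ε (t + 3 + e) (t + 1) = ρ := by
      simp [scmCoeff, show t + 1 ≠ t + 3 + e by omega]
    have b0 : breakMode ρ ε q (t + 3 + e) t = ρ * q ^ (e + 2) := by
      rw [breakMode, if_pos (by omega)]; congr 2; omega
    have b1 : breakMode ρ ε q (t + 3 + e) (t + 1) = ρ * q ^ (e + 1) := by
      rw [breakMode, if_pos (by omega)]; congr 2; omega
    have b2 : breakMode ρ ε q (t + 3 + e) (t + 2) = ρ * q ^ e := by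
      rw [breakMode, if_pos (by omega)]; congr 2; omega
    rw [a1, a2, b0, b1, b2]
    linear_combination (-ρ * q ^ e) * hx
  rcases h.eq_or_lt with rfl | h
  · have a1 : scmCoeff ρ ε (t + 2) (t + 2) = ρ + ε := by simp [scmCoeff]
    have a2 : scmCoeff ρ ε (t + 2) (t + 1) = ρ := by simp [scmCoeff]
    have b0 : breakMode ρ ε q (t + 2) t = ρ * q := by
      rw [breakMode, if_pos (by omega), show t + 2 - 1 - t = 1 by omega, pow_one]
    have b1 : breakMode ρ ε q (t + 2) (t + 1) = ρ := by
      rw [breakMode, if_pos (by omega), show t + 2 - 1 - (t + 1) = 0 by omega]; simp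
    have b2 : breakMode ρ ε q (t + 2) (t + 2) = (ρ + ε) * q := by
      rw [breakMode, if_neg (by omega)]; simp
    rw [a1, a2, b0, b1, b2]
    refine mul_left_cancel₀ hq0 ?_
    linear_combination (-ρ) * hx + hq
  rcases (show k ≤ t + 1 by omega).eq_or_lt with rfl | h'
  · have a1 : scmCoeff ρ ε (t + 1) (t + 2) = ρ := by simp [scmCoeff]
    have a2 : scmCoeff ρ ε (t + 1) (t + 1) = ρ + ε := by simp [scmCoeff]
    have b0 : breakMode ρ ε q (t + 1) t = ρ := by
      rw [breakMode, if_pos (by omega), show t + 1 - 1 - t = 0 by omega]; simp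
    have b1 : breakMode ρ ε q (t + 1) (t + 1) = (ρ + ε) * q := by
      rw [breakMode, if_neg (by omega)]; simp
    have b2 : breakMode ρ ε q (t + 1) (t + 2) = (ρ + ε) * q ^ 2 := by
      rw [breakMode, if_neg (by omega), show t + 2 - (t + 1) + 1 = 2 by omega]
    rw [a1, a2, b0, b1, b2]
    linear_combination (-(ρ + ε)) * hx
  · obtain ⟨e, rfl⟩ : ∃ e, t = k + e := ⟨t - k, by omega⟩
    have a1 : scmCoeff ρ ε k (k + e + 2) = ρ := by simp [scmCoeff, show k + e + 2 ≠ k by omega]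
    have a2 : scmCoeff ρ ε k (k + e + 1) = ρ := by simp [scmCoeff, show k + e + 1 ≠ k by omega]
    have b0 : breakMode ρ ε q k (k + e) = (ρ + ε) * q ^ (e + 1) := by
      rw [breakMode, if_neg (by omega)]; congr 2; omega
    have b1 : breakMode ρ ε q k (k + e + 1) = (ρ + ε) * q ^ (e + 2) := by
      rw [breakMode, if_neg (by omega)]; congr 2; omega
    have b2 : breakMode ρ ε q k (k + e + 2) = (ρ + ε) * q ^ (e + 3) := by
      rw [breakMode, if_neg (by omega)]; congr 2; omega
    rw [a1, a2, b0, b1, b2]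
    linear_combination (-(ρ + ε) * q ^ (e + 1)) * hx

/-- The recurrence holds on all times, so the residual consists only of the terms cut off at times
`0` and `n + 1`. As `2 ≤ k ≤ n`, the coefficients there are both `ρ`. -/
theorem arGram_mulVec_breakMode_sub {ρ ε q : ℝ} (hq0 : q ≠ 0)
    (hq : -(ε + ρ) ^ 2 * q ^ 2 + ε * ρ * (ε + 2 * ρ) * q + ρ ^ 2 = 0) {k n : ℕ} (hk : 2 ≤ k)
    (hkn : k ≤ n) (i : Fin n) :
    (arGram (scmCoeff ρ ε k) n).mulVec (fun j => breakMode ρ ε q k (j.val + 1)) i -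
        spectralMap ρ q * breakMode ρ ε q k (i.val + 1) =
      (if i.val = 0 then ρ * breakMode ρ ε q k 0 else 0) +
        if i.val + 1 = n then
          ρ * (breakMode ρ ε q k (n + 1) - ρ * breakMode ρ ε q k n) else 0 := by
  have h := sum_arGram_row (scmCoeff ρ ε k) i
    (fun t => if t = 0 then 0 else breakMode ρ ε q k t) (by simp)
  simp only [Nat.add_eq_zero_iff, one_ne_zero, and_false, if_false, OfNat.ofNat_ne_zero] at h
  simp only [Matrix.mulVec, dotProduct]
  rw [h, ← breakMode_eigen hq0 hq hk i.val]
  have h0 : scmCoeff ρ ε k (i.val + 1) * (if i.val = 0 then 0 else breakMode ρ ε q k i.val) =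
      scmCoeff ρ ε k (i.val + 1) * breakMode ρ ε q k i.val -
        if i.val = 0 then ρ * breakMode ρ ε q k 0 else 0 := by
    split_ifs with hi
    · rw [hi]
      simp [scmCoeff, show 1 ≠ k by omega]
    · ring
  rw [h0]
  by_cases hn : i.val + 1 = n
  · have e1 : scmCoeff ρ ε k (i.val + 2) = ρ := by
      simp [scmCoeff, show i.val + 2 ≠ k by omega]
    have e2 : breakMode ρ ε q k n = breakMode ρ ε q k (i.val + 1) := congrArg _ hn.symm
    have e3 : breakMode ρ ε q k (n + 1) = breakMode ρ ε q k (i.val + 2) :=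
      congrArg _ (by omega)
    simp only [hn, lt_irrefl, if_true, if_false, e1, e2, e3]
    ring
  · simp only [show i.val + 1 < n by omega, hn, if_true, if_false]
    ring

theorem tendsto_infDist_spectralMap {ρ ε q : ℝ} (hρ0 : ρ ≠ 0) (hq0 : q ≠ 0) (hq1 : |q| < 1)
    (hq : -(ε + ρ) ^ 2 * q ^ 2 + ε * ρ * (ε + 2 * ρ) * q + ρ ^ 2 = 0) {k : ℕ → ℕ}
    (hk : ∀ n, 1 ≤ n → k n ≤ n) (hk_top : Tendsto k atTop atTop)
    (hnk : Tendsto (fun n => n - k n) atTop atTop) :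
    Tendsto (fun n => Metric.infDist (spectralMap ρ q)
      (spectrum ℝ (arGram (scmCoeff ρ ε (k n)) n))) atTop (𝓝 0) := by
  have hpow := tendsto_pow_atTop_nhds_zero_of_abs_lt_one hq1
  have hl : Tendsto (fun n => breakMode ρ ε q (k n) 0) atTop (𝓝 0) := by
    have h1 : Tendsto (fun n => k n - 1) atTop atTop := (tendsto_sub_atTop_nat 1).comp hk_top
    have h2 := (hpow.comp h1).const_mul ρ
    rw [mul_zero] at h2
    refine h2.congr' ?_
    filter_upwards [hk_top.eventually_ge_atTop 1] with n hn
    simp [breakMode, show 0 < k n by omega]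
  have hr : ∀ u : ℕ → ℕ, (∀ n, n ≤ u n) →
      Tendsto (fun n => breakMode ρ ε q (k n) (u n)) atTop (𝓝 0) := by
    intro u hu
    have h1 : Tendsto (fun n => u n - k n + 1) atTop atTop :=
      tendsto_atTop_mono (fun n => by have := hu n; omega) hnk
    have h2 := (hpow.comp h1).const_mul (ρ + ε)
    rw [mul_zero] at h2
    refine h2.congr' ?_
    filter_upwards [eventually_ge_atTop 1] with n hn
    have := hk n hn
    have := hu n
    simp [breakMode, show ¬ u n < k n by omega]
  have hE : Tendsto (fun n => 2 * (ρ * breakMode ρ ε q (k n) 0) ^ 2 +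
      2 * (ρ * (breakMode ρ ε q (k n) (n + 1) - ρ * breakMode ρ ε q (k n) n)) ^ 2)
      atTop (𝓝 0) := by
    have := (((hl.const_mul ρ).pow 2).const_mul 2).add
      (((((hr (fun n => n + 1) (fun n => by omega)).sub
        ((hr (fun n => n) fun n => le_rfl).const_mul ρ)).const_mul ρ).pow 2).const_mul 2)
    simpa using this
  refine tendsto_order.mpr ⟨fun b hb => Eventually.of_forall fun n =>
    hb.trans_le Metric.infDist_nonneg, fun d hd => ?_⟩
  filter_upwards [hE.eventually_lt_const (show 0 < d ^ 2 * ρ ^ 2 by positivity),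
    hk_top.eventually_ge_atTop 2, eventually_ge_atTop 1] with n hn hk2 hn1
  have hkn := hk n hn1
  refine (arGram_isHermitian _ n).infDist_spectrum_lt hd
    (fun j => breakMode ρ ε q (k n) (j.val + 1)) ?_
  set α := ρ * breakMode ρ ε q (k n) 0
  set β := ρ * (breakMode ρ ε q (k n) (n + 1) - ρ * breakMode ρ ε q (k n) n)
  -- The entry at time `k - 1`, which has index `k - 2`, equals `ρ`; this keeps the norm away from
  -- zero.
  have hnorm : ρ ^ 2 ≤ ∑ j : Fin n, breakMode ρ ε q (k n) (j.val + 1) ^ 2 := by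
    have h1 : breakMode ρ ε q (k n) (k n - 2 + 1) = ρ := by
      rw [breakMode, if_pos (by omega), show k n - 1 - (k n - 2 + 1) = 0 by omega]; simp
    have h2 := Finset.single_le_sum
      (f := fun j : Fin n => breakMode ρ ε q (k n) (j.val + 1) ^ 2)
      (fun _ _ => sq_nonneg _) (Finset.mem_univ ⟨k n - 2, by omega⟩)
    simpa only [h1] using h2
  have hres : ∀ i : Fin n, ((arGram (scmCoeff ρ ε (k n)) n).mulVec
      (fun j => breakMode ρ ε q (k n) (j.val + 1)) i -
        spectralMap ρ q * breakMode ρ ε q (k n) (i.val + 1)) ^ 2 ≤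
      (if i.val = 0 then 2 * α ^ 2 else 0) + if i.val = n - 1 then 2 * β ^ 2 else 0 := by
    intro i
    rw [arGram_mulVec_breakMode_sub hq0 hq hk2 hkn]
    simp only [show i.val + 1 = n ↔ i.val = n - 1 by omega]
    split_ifs <;> nlinarith [sq_nonneg (α - β), sq_nonneg α, sq_nonneg β]
  calc _ ≤ ∑ i : Fin n, ((if i.val = 0 then 2 * α ^ 2 else 0) +
        if i.val = n - 1 then 2 * β ^ 2 else 0) := Finset.sum_le_sum fun i _ => hres i
    _ = 2 * α ^ 2 + 2 * β ^ 2 := by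
      rw [Fin.sum_univ_eq_sum_range (fun t => (if t = 0 then 2 * α ^ 2 else 0) +
        if t = n - 1 then 2 * β ^ 2 else 0), Finset.sum_add_distrib, Finset.sum_ite_eq',
        Finset.sum_ite_eq', if_pos (Finset.mem_range.mpr (by omega)),
        if_pos (Finset.mem_range.mpr (by omega))]
    _ < d ^ 2 * ρ ^ 2 := hn
    _ ≤ _ := mul_le_mul_of_nonneg_left hnorm (sq_nonneg d)

/-! ### Position of the roots and of the outliers -/

theorem scm_quadratic_of_eq {ρ ε w : ℝ} (hc : ε + ρ ≠ 0)
    (hw : w ^ 2 = ρ ^ 2 * ε ^ 2 * (ε + 2 * ρ) ^ 2 + 4 * ρ ^ 2 * (ε + ρ) ^ 2) {q : ℝ}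
    (hq : q = (ρ * ε * (ε + 2 * ρ) + w) / (2 * (ε + ρ) ^ 2)) :
    -(ε + ρ) ^ 2 * q ^ 2 + ε * ρ * (ε + 2 * ρ) * q + ρ ^ 2 = 0 := by
  rw [hq]
  field_simp
  linear_combination (-1) * hw

/-- With `A = (ε + ρ)² > ρ²`, the quadratic is `ρ² > 0` at `0` and `-(A - ρ²)(1 ∓ ρ) < 0` at `±1`,
so it has one root on each side of `0` inside `(-1, 1)`. The bounds on `√D` below express these
signs. -/
theorem scm_roots {ρ ε : ℝ} (hρ : |ρ| < 1) (hρ0 : ρ ≠ 0) (h : |ρ| < |ρ + ε|) :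
    (-1 < rootS ρ ε ∧ rootS ρ ε < 0 ∧ 0 < rootT ρ ε ∧ rootT ρ ε < 1) ∧
    (-(ε + ρ) ^ 2 * rootS ρ ε ^ 2 + ε * ρ * (ε + 2 * ρ) * rootS ρ ε + ρ ^ 2 = 0) ∧
    (-(ε + ρ) ^ 2 * rootT ρ ε ^ 2 + ε * ρ * (ε + 2 * ρ) * rootT ρ ε + ρ ^ 2 = 0) := by
  have hsq : ρ ^ 2 < (ε + ρ) ^ 2 := by rw [add_comm ε]; exact sq_lt_sq.mpr h
  have hρp : 0 < ρ ^ 2 := by positivity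
  have hc : ε + ρ ≠ 0 := by
    intro h0; rw [h0] at hsq; nlinarith
  rw [abs_lt] at hρ
  set D := ρ ^ 2 * ε ^ 2 * (ε + 2 * ρ) ^ 2 + 4 * ρ ^ 2 * (ε + ρ) ^ 2 with hD
  set B := ρ * ε * (ε + 2 * ρ) with hB
  have hBc : B = ρ * ((ε + ρ) ^ 2 - ρ ^ 2) := by rw [hB]; ring
  have hDB : D = B ^ 2 + 4 * ρ ^ 2 * (ε + ρ) ^ 2 := by rw [hD, hB]; ring
  set A := (ε + ρ) ^ 2 with hA
  have hA0 : 0 < A := by positivity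
  have hAρ : 0 < A * ρ ^ 2 := by positivity
  have hD0 : 0 ≤ D := by rw [hDB]; positivity
  have e1 : 0 < (1 + ρ) * (A - ρ ^ 2) := mul_pos (by linarith) (by linarith)
  have e2 : 0 < (1 - ρ) * (A - ρ ^ 2) := mul_pos (by linarith) (by linarith)
  have hlow : |B| < √D := Real.lt_sqrt_of_sq_lt (by rw [sq_abs, hDB]; nlinarith)
  have hup1 : √D < B + 2 * A := by
    refine (Real.sqrt_lt' (by rw [hBc]; nlinarith)).mpr ?_
    have : 0 < A * (B + A - ρ ^ 2) := mul_pos hA0 (by rw [hBc]; nlinarith)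
    rw [hDB]; nlinarith
  have hup2 : √D < 2 * A - B := by
    refine (Real.sqrt_lt' (by rw [hBc]; nlinarith)).mpr ?_
    have : 0 < A * (A - B - ρ ^ 2) := mul_pos hA0 (by rw [hBc]; nlinarith)
    rw [hDB]; nlinarith
  rw [abs_lt] at hlow
  have hS : rootS ρ ε = (B - √D) / (2 * A) := rfl
  have hT : rootT ρ ε = (B + √D) / (2 * A) := rfl
  refine ⟨⟨?_, ?_, ?_, ?_⟩, ?_, ?_⟩
  · rw [hS, lt_div_iff₀ (by positivity)]; linarith
  · rw [hS]; exact div_neg_of_neg_of_pos (by linarith) (by positivity)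
  · rw [hT]; exact div_pos (by linarith) (by positivity)
  · rw [hT, div_lt_one (by positivity)]; linarith
  · exact scm_quadratic_of_eq hc (w := -√D) (by rw [neg_sq, Real.sq_sqrt hD0])
      (by rw [hS]; ring)
  · exact scm_quadratic_of_eq hc (w := √D) (Real.sq_sqrt hD0) hT

theorem two_lt_add_inv {q : ℝ} (h0 : 0 < q) (h1 : q < 1) : 2 < q + q⁻¹ := by
  have : 0 < (1 - q) ^ 2 / q := div_pos (by nlinarith) h0
  have e : (1 - q) ^ 2 / q = q + q⁻¹ - 2 := by field_simp; ring
  linarith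

theorem add_inv_lt_neg_two {q : ℝ} (h0 : q < 0) (h1 : -1 < q) : q + q⁻¹ < -2 := by
  have := two_lt_add_inv (q := -q) (by linarith) (by linarith)
  rw [inv_neg] at this
  linarith

/-- For `0 < |q| < 1` one has `|q + q⁻¹| > 2`, which pushes `spectralMap ρ q` out of the bulk: to
the left when `ρ q > 0`, to the right when `ρ q < 0`. Hence the case split on the sign of `ρ`. -/
theorem outlierLeft_lt {ρ ε : ℝ} (hρ : |ρ| < 1) (hρ0 : ρ ≠ 0) (h : |ρ| < |ρ + ε|) :
    outlierLeft ρ ε < aBound ρ := by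
  obtain ⟨⟨h1, h2, h3, h4⟩, -, -⟩ := scm_roots hρ hρ0 h
  unfold outlierLeft aBound spectralMap
  split_ifs with hneg
  · have := add_inv_lt_neg_two h2 h1
    rw [abs_of_neg hneg]
    nlinarith
  · have hpos : 0 < ρ := lt_of_le_of_ne (not_lt.mp hneg) hρ0.symm
    have := two_lt_add_inv h3 h4
    rw [abs_of_pos hpos]
    nlinarith

theorem lt_outlierRight {ρ ε : ℝ} (hρ : |ρ| < 1) (hρ0 : ρ ≠ 0) (h : |ρ| < |ρ + ε|) :
    bBound ρ < outlierRight ρ ε := by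
  obtain ⟨⟨h1, h2, h3, h4⟩, -, -⟩ := scm_roots hρ hρ0 h
  unfold outlierRight bBound spectralMap
  split_ifs with hneg
  · have := two_lt_add_inv h3 h4
    rw [abs_of_neg hneg]
    nlinarith
  · have hpos : 0 < ρ := lt_of_le_of_ne (not_lt.mp hneg) hρ0.symm
    have := add_inv_lt_neg_two h2 h1
    rw [abs_of_pos hpos]
    nlinarith

/-! ### The main theorem -/

theorem theorem3p2 {Ω : Type*} [MeasurableSpace Ω] (P : Measure Ω) [IsProbabilityMeasure P]
    (z : ℕ → Ω → ℝ) (hz : IsWhiteNoise P z)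
    (ρ ε : ℝ) (hρ : |ρ| < 1) (hρ0 : ρ ≠ 0) (hε : ε ≠ 0)
    (k : ℕ → ℕ) (hk : ∀ n, 1 ≤ n → 1 ≤ k n ∧ k n ≤ n) (hk_top : Tendsto k atTop atTop) :
    -- `μ_ρ` is the asymptotic spectral distribution of `B_n`, with support `[a_ρ, b_ρ]`
    HasASD (fun n => scmPrecision P z ρ ε (k n) n) (muRho ρ) ∧
    (muRho ρ).support = Set.Icc (aBound ρ) (bBound ρ) ∧
    -- no outliers when `|ρ + ε| ≤ |ρ|`
    (|ρ + ε| ≤ |ρ| →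
      leftOutliers (fun n => scmPrecision P z ρ ε (k n) n) (muRho ρ) (aBound ρ) = ∅ ∧
      rightOutliers (fun n => scmPrecision P z ρ ε (k n) n) (muRho ρ) (bBound ρ) = ∅) ∧
    -- exactly one left and one right outlier when `|ρ| < |ρ + ε|`
    (|ρ| < |ρ + ε| → Tendsto (fun n => n - k n) atTop atTop →
      leftOutliers (fun n => scmPrecision P z ρ ε (k n) n) (muRho ρ) (aBound ρ) =
        {outlierLeft ρ ε} ∧
      rightOutliers (fun n => scmPrecision P z ρ ε (k n) n) (muRho ρ) (bBound ρ) =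
        {outlierRight ρ ε}) := by
  have hB : (fun n => scmPrecision P z ρ ε (k n) n) =
      fun n => arGram (scmCoeff ρ ε (k n)) n := by
    funext n
    exact precisionMatrix_arProcess hz _ n
  rw [hB]
  have hH : ∀ n, (arGram (scmCoeff ρ ε (k n)) n).IsHermitian := fun n => arGram_isHermitian _ n
  have hcl : closure (muRho ρ).support = Set.Icc (aBound ρ) (bBound ρ) := by
    rw [support_muRho hρ0, isClosed_Icc.closure_eq]
  refine ⟨hasASD_arGram ρ ε k, support_muRho hρ0, fun hle => ?_, fun hlt hnk => ?_⟩
  · have hempty : outliers (fun n => arGram (scmCoeff ρ ε (k n)) n) (muRho ρ) = ∅ := by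
      refine Set.eq_empty_of_forall_notMem fun x hx => hx.2 ?_
      rw [hcl]
      exact mem_Icc_of_tendsto_infDist_spectrum hH
        (fun n => spectrum_arGram_subset (abs_nonneg ρ) hρ.le
          (abs_scmCoeff_le_of_abs_add_le hle (k n))) hx.1
    simp [leftOutliers, rightOutliers, hempty]
  · obtain ⟨⟨h1, h2, h3, h4⟩, hS, hT⟩ := scm_roots hρ hρ0 hlt
    have tS := tendsto_infDist_spectralMap hρ0 h2.ne (abs_lt.mpr ⟨h1, by linarith⟩) hS
      (fun n hn => (hk n hn).2) hk_top hnk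
    have tT := tendsto_infDist_spectralMap hρ0 h3.ne' (abs_lt.mpr ⟨by linarith, h4⟩) hT
      (fun n hn => (hk n hn).2) hk_top hnk
    have tL : Tendsto (fun n => Metric.infDist (outlierLeft ρ ε)
        (spectrum ℝ (arGram (scmCoeff ρ ε (k n)) n))) atTop (𝓝 0) := by
      unfold outlierLeft; split_ifs <;> assumption
    have tR : Tendsto (fun n => Metric.infDist (outlierRight ρ ε)
        (spectrum ℝ (arGram (scmCoeff ρ ε (k n)) n))) atTop (𝓝 0) := by
      unfold outlierRight; split_ifs <;> assumption
    have hL := outlierLeft_lt hρ hρ0 hlt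
    have hR := lt_outlierRight hρ hρ0 hlt
    constructor
    · refine Set.eq_singleton_iff_unique_mem.mpr ⟨⟨⟨tL, ?_⟩, hL⟩, fun x hx => ?_⟩
      · rw [hcl]
        exact fun h => absurd h.1 (not_le.mpr hL)
      · exact eq_of_tendsto_infDist_spectrum hH isOpen_Iio
          (fun n l hl m hm hla hma => eq_of_spectrum_lt_aBound hρ.le hl hm hla hma)
          hx.2 hL hx.1.1 tL
    · refine Set.eq_singleton_iff_unique_mem.mpr ⟨⟨⟨tR, ?_⟩, hR⟩, fun x hx => ?_⟩
      · rw [hcl]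
        exact fun h => absurd h.2 (not_le.mpr hR)
      · exact eq_of_tendsto_infDist_spectrum hH isOpen_Ioi
          (fun n l hl m hm hla hma => eq_of_bBound_lt_spectrum hl hm hla hma)
          hx.2 hR hx.1.1 tR
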